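/- All graphs are finite and simple. For a graph $G$ of order $n$, let $m(G,k)$ be the number of sets of $k$ pairwise nonincident edges of $G$ (so $m(G,0)=1$), and let $\mu(G,x)=\sum_{k\ge 0}(-1)^k m(G,k)\,x^{n-2k}$ be its matching polynomial. The graph $G$ is called matching unique if every graph $H$ with $\mu(H,x)=\mu(G,x)$ is isomorphic to $G$. For integers $k\ge 1$, $t\ge 0$ and $1\le \ell\le k$, let $K(k,t;\ell)$ be the graph obtained from the disjoint union of the star $K_{1,k}$ and $t$ isolated vertices by adding a new vertex $u$ that is adjacent to all $t$ isolated vertices and to exactly $\ell$ leaves of the star, but not to its center. Let $K'(k,t;\ell)$ be the graph obtained from $K(k,t;\ell)$ by also joining $u$ to the center of the star. (For $k=1$, one fixed vertex of $K_{1,1}$ is regarded as the center and the other as the leaf.) Put $S(t)=K(1,t;1)$ and $S'(t)=K'(1,t;1)$. **Theorem.** For every integer $t\ge 0$: 1. $S(t)$ is matching unique if and only if $t\notin\{2,3,4\}$; 2. $S'(t)$ is matching unique if and only if $t\notin\{2,3\}$. -/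

import Mathlib

open Polynomial

/-- `matchingNumber G k` is the number `m(G, k)` of `k`-matchings of `G`, that is, of sets of `k`
pairwise nonincident edges of `G`. -/
noncomputable def matchingNumber {V : Type*} (G : SimpleGraph V) (k : ℕ) : ℕ :=
  Set.ncard {M : Finset (Sym2 V) | (M : Set (Sym2 V)) ⊆ G.edgeSet ∧ M.card = k ∧
    ∀ e ∈ M, ∀ f ∈ M, e ≠ f → ∀ v : V, ¬ (v ∈ e ∧ v ∈ f)}

/-- The matching polynomial `∑ₖ (-1)ᵏ m(G, k) x^(n - 2k)` of a finite graph of order `n`.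
A `k`-matching covers `2k` vertices, so only the indices `k ≤ n / 2` contribute. -/
noncomputable def matchingPolynomial {V : Type*} [Fintype V] (G : SimpleGraph V) : ℤ[X] :=
  ∑ k ∈ Finset.range (Fintype.card V / 2 + 1),
    C ((-1 : ℤ) ^ k * (matchingNumber G k : ℤ)) * X ^ (Fintype.card V - 2 * k)

/-- Two finite graphs are comatching if they are nonisomorphic and have the same matching
polynomial. -/
def IsComatching {V W : Type*} [Fintype V] [Fintype W]
    (G : SimpleGraph V) (H : SimpleGraph W) : Prop :=
  IsEmpty (G ≃g H) ∧ matchingPolynomial G = matchingPolynomial H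

/-- A finite graph is matching unique if it has no comatching (finite, simple) graph. -/
def IsMatchingUnique {V : Type} [Fintype V] (G : SimpleGraph V) : Prop :=
  ∀ (W : Type) [Fintype W] (H : SimpleGraph W), ¬ IsComatching G H

/-- The vertices of `K(k, t; ℓ)` and `K'(k, t; ℓ)`: the added vertex `u` is `inl true`, the center
of the star `K_{1,k}` is `inl false`, the leaves of the star are `inr (inl i)`, and the vertices of
`t K₁` are `inr (inr j)`. -/
abbrev KVertex (k t : ℕ) : Type := Bool ⊕ (Fin k ⊕ Fin t)

/-- The edges of `K(k, t; ℓ)`, each in one direction. -/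
def KRel (k t l : ℕ) : KVertex k t → KVertex k t → Prop
  | Sum.inl false, Sum.inr (Sum.inl _) => True
  | Sum.inl true, Sum.inr (Sum.inl i) => (i : ℕ) < l
  | Sum.inl true, Sum.inr (Sum.inr _) => True
  | _, _ => False

/-- The graph `K(k, t; ℓ)` (for `1 ≤ ℓ ≤ k`): to `K_{1,k} ∪ t K₁` a vertex `u` is added, adjacent
to the `t` isolated vertices and to `ℓ` leaves of the star, but not to its center. -/
def KGraph (k t l : ℕ) : SimpleGraph (KVertex k t) :=
  SimpleGraph.fromRel (KRel k t l)

/-- The graph `K'(k, t; ℓ)`: the graph `K(k, t; ℓ)` with `u` joined to the center as well. -/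
def KGraph' (k t l : ℕ) : SimpleGraph (KVertex k t) :=
  KGraph k t l ⊔ SimpleGraph.edge (Sum.inl true) (Sum.inl false)

/-- `S(t) = K(1, t; 1)`. -/
def SGraph (t : ℕ) : SimpleGraph (KVertex 1 t) := KGraph 1 t 1

/-- `S'(t) = K'(1, t; 1)`. -/
def SGraph' (t : ℕ) : SimpleGraph (KVertex 1 t) := KGraph' 1 t 1

/-! `S(t)` has fewer 2-matchings than edges: `t` against `t + 2`, and for `S'(t)` it is `t` against
`t + 3`. In a graph with this property the average number of edges nonincident to a given edge is
below 2, so some edge `xy` misses at most one edge `zw`. The graph is then a double star on `xy`,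
whose leaf sets `A` and `B` may overlap, with at most the edge `zw` added (`exists_eq_doubleStar`).

Write a ≤ b for the sizes of `A` and `B`, c for that of `A ∩ B`, and a', b' for the numbers of ends
of `zw` in `A` and `B`. The double star has a + b + 1 edges and ab - c 2-matchings; adding `zw`
creates a + b + 1 - a' - b' more. Equating these counts with those of `S(t)` or `S'(t)` forces a ≤
2. Outside the exceptional `t` the surviving solutions are all copies of the given graph, so the
order and the numbers of edges and 2-matchings already determine it.

For each exceptional `t` an explicit graph with an isolated vertex has the same matching numbers,
while `S(t)` and `S'(t)` have no isolated vertex. -/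

section Matchings

/-! ### Nonincident edges and double stars -/

variable {V : Type*}

/-- Two edges are nonincident if they have no common endpoint. -/
abbrev Nonincident (e f : Sym2 V) : Prop := ∀ v : V, ¬ (v ∈ e ∧ v ∈ f)

theorem not_nonincident_self (e : Sym2 V) : ¬ Nonincident e e := by
  induction e with
  | _ x y => exact fun h => h x ⟨Sym2.mem_mk_left x y, Sym2.mem_mk_left x y⟩

theorem nonincident_comm {e f : Sym2 V} : Nonincident e f ↔ Nonincident f e :=
  forall_congr' fun _ => not_congr and_comm

/-- The centers of a double star are distinct and do not belong to the sets of leaves. -/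
structure IsDoubleStar (x y : V) (A B : Finset V) : Prop where
  ne : x ≠ y
  left_notMem_left : x ∉ A
  right_notMem_left : y ∉ A
  left_notMem_right : x ∉ B
  right_notMem_right : y ∉ B

theorem IsDoubleStar.symm {x y : V} {A B : Finset V} (h : IsDoubleStar x y A B) :
    IsDoubleStar y x B A :=
  ⟨h.ne.symm, h.right_notMem_right, h.left_notMem_right, h.right_notMem_left,
    h.left_notMem_left⟩

theorem nonincident_mk {x y z w : V} :
    Nonincident s(x, y) s(z, w) ↔ (x ≠ z ∧ x ≠ w) ∧ (y ≠ z ∧ y ≠ w) := by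
  simp only [Nonincident, Sym2.mem_iff]
  constructor
  · intro h
    have hx := h x
    have hy := h y
    tauto
  · rintro ⟨⟨h1, h2⟩, h3, h4⟩ v ⟨rfl | rfl, h | h⟩ <;> contradiction

theorem IsDoubleStar.mono {x y : V} {A B A' B' : Finset V} (h : IsDoubleStar x y A B)
    (hA : A' ⊆ A) (hB : B' ⊆ B) : IsDoubleStar x y A' B' :=
  ⟨h.ne, fun hx => h.left_notMem_left (hA hx), fun hx => h.right_notMem_left (hA hx),
    fun hx => h.left_notMem_right (hB hx), fun hx => h.right_notMem_right (hB hx)⟩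

variable [DecidableEq V]

/-- The edges of the graph consisting of the edge `xy`, of edges from `x` to all vertices
of `A`, and of edges from `y` to all vertices of `B`. -/
def doubleStar (x y : V) (A B : Finset V) : Finset (Sym2 V) :=
  insert s(x, y) (A.image (fun p => s(x, p)) ∪ B.image (fun p => s(y, p)))

theorem doubleStar_symm (x y : V) (A B : Finset V) :
    doubleStar x y A B = doubleStar y x B A := by
  rw [doubleStar, doubleStar, Finset.union_comm, Sym2.eq_swap]

theorem mem_doubleStar {x y : V} {A B : Finset V} {e : Sym2 V} :
    e ∈ doubleStar x y A B ↔
      e = s(x, y) ∨ (∃ p ∈ A, e = s(x, p)) ∨ ∃ p ∈ B, e = s(y, p) := by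
  simp only [doubleStar, Finset.mem_insert, Finset.mem_union, Finset.mem_image, eq_comm]

theorem IsDoubleStar.card {x y : V} {A B : Finset V} (h : IsDoubleStar x y A B) :
    (doubleStar x y A B).card = A.card + B.card + 1 := by
  obtain ⟨h1, h2, h3, h4, h5⟩ := h
  rw [doubleStar, Finset.card_insert_of_notMem, Finset.card_union_of_disjoint,
    Finset.card_image_of_injective, Finset.card_image_of_injective]
  · intro p q hpq
    exact Sym2.congr_right.1 hpq
  · intro p q hpq
    exact Sym2.congr_right.1 hpq
  · rw [Finset.disjoint_left]
    intro e he he'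
    obtain ⟨p, hp, rfl⟩ := Finset.mem_image.1 he
    obtain ⟨q, hq, hpq⟩ := Finset.mem_image.1 he'
    rcases Sym2.eq_iff.1 hpq with ⟨h, -⟩ | ⟨-, h⟩
    · exact h1 h.symm
    · exact h4 (h ▸ hq)
  · simp only [Finset.mem_union, Finset.mem_image, not_or, not_exists, not_and]
    constructor
    · rintro p hp hpq
      rw [Sym2.congr_right.1 hpq] at hp
      exact h3 hp
    · rintro p hp hpq
      rw [Sym2.eq_swap (a := x), Sym2.congr_right] at hpq
      exact h4 (hpq ▸ hp)

theorem left_or_right_mem_of_mem_doubleStar {x y : V} {A B : Finset V} {e : Sym2 V}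
    (he : e ∈ doubleStar x y A B) : x ∈ e ∨ y ∈ e := by
  rcases mem_doubleStar.1 he with rfl | ⟨p, -, rfl⟩ | ⟨p, -, rfl⟩ <;> simp

theorem notMem_doubleStar {x y z w : V} {A B : Finset V} (hxz : x ≠ z) (hxw : x ≠ w)
    (hyz : y ≠ z) (hyw : y ≠ w) : s(z, w) ∉ doubleStar x y A B := by
  intro h
  rcases left_or_right_mem_of_mem_doubleStar h with h | h
  · rcases Sym2.mem_iff.1 h with h | h
    exacts [hxz h, hxw h]
  · rcases Sym2.mem_iff.1 h with h | h
    exacts [hyz h, hyw h]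

/-! ### Counting matchings in a finite edge set -/

variable [Fintype V]

/-- The `k`-matchings whose edges belong to the finite set `E`. -/
def matchings (E : Finset (Sym2 V)) (k : ℕ) : Finset (Finset (Sym2 V)) :=
  (E.powersetCard k).filter fun M => ∀ e ∈ M, ∀ f ∈ M, e ≠ f → Nonincident e f

theorem mem_matchings {E : Finset (Sym2 V)} {k : ℕ} {M : Finset (Sym2 V)} :
    M ∈ matchings E k ↔
      (M ⊆ E ∧ M.card = k) ∧ ∀ e ∈ M, ∀ f ∈ M, e ≠ f → Nonincident e f := by
  simp only [matchings, Finset.mem_filter, Finset.mem_powersetCard]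

theorem matchingNumber_eq_card {G : SimpleGraph V} {E : Finset (Sym2 V)}
    (hE : (E : Set (Sym2 V)) = G.edgeSet) (k : ℕ) :
    matchingNumber G k = (matchings E k).card := by
  rw [matchingNumber, ← Set.ncard_coe_finset]
  congr 1
  ext M
  simp only [Set.mem_ofPred_eq, Finset.mem_coe, mem_matchings, ← hE, Finset.coe_subset, and_assoc]

theorem card_matchings_one (E : Finset (Sym2 V)) : (matchings E 1).card = E.card := by
  rw [matchings, Finset.filter_true_of_mem, Finset.card_powersetCard, Nat.choose_one_right]
  intro M hM e he f hf hne
  obtain ⟨g, rfl⟩ := Finset.card_eq_one.1 (Finset.mem_powersetCard.1 hM).2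
  simp_all

theorem card_matchings_zero (E : Finset (Sym2 V)) : (matchings E 0).card = 1 := by
  simp [matchings, Finset.filter_singleton]

theorem pair_mem_matchings {E : Finset (Sym2 V)} {e f : Sym2 V} (he : e ∈ E) (hf : f ∈ E)
    (h : Nonincident e f) : {e, f} ∈ matchings E 2 := by
  have hne : e ≠ f := by
    rintro rfl
    exact not_nonincident_self e h
  refine mem_matchings.2 ⟨⟨?_, Finset.card_pair hne⟩, ?_⟩
  · simp [Finset.insert_subset_iff, he, hf]
  · intro a ha b hb hab
    simp only [Finset.mem_insert, Finset.mem_singleton] at ha hb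
    rcases ha with rfl | rfl <;> rcases hb with rfl | rfl
    · exact absurd rfl hab
    · exact h
    · exact nonincident_comm.1 h
    · exact absurd rfl hab

/-- The 2-matchings through `f` are the pairs `{f, g}` with `g` in `E` nonincident to `f`. -/
theorem card_matchings_two_insert {E : Finset (Sym2 V)} {f : Sym2 V} (hf : f ∉ E) :
    (matchings (insert f E) 2).card =
      (matchings E 2).card + (E.filter (Nonincident f)).card := by
  have h : matchings (insert f E) 2 =
      matchings E 2 ∪ (E.filter (Nonincident f)).image (fun g => {f, g}) := by
    ext M
    simp only [Finset.mem_union, Finset.mem_image, Finset.mem_filter]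
    constructor
    · intro hM
      obtain ⟨⟨hsub, hcard⟩, hdis⟩ := mem_matchings.1 hM
      by_cases hfM : f ∈ M
      · right
        obtain ⟨g, hg⟩ := Finset.card_eq_one.1
          (show (M.erase f).card = 1 by rw [Finset.card_erase_of_mem hfM, hcard])
        have hgM : g ∈ M.erase f := by simp [hg]
        obtain ⟨hgf, hgM⟩ := Finset.mem_erase.1 hgM
        refine ⟨g, ⟨?_, hdis f hfM g hgM hgf.symm⟩, ?_⟩
        · exact (Finset.mem_insert.1 (hsub hgM)).resolve_left hgf
        · rw [← Finset.insert_erase hfM, hg]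
      · left
        exact mem_matchings.2 ⟨⟨(Finset.subset_insert_iff_of_notMem hfM).1 hsub, hcard⟩, hdis⟩
    · rintro (hM | ⟨g, ⟨hg, hfg⟩, rfl⟩)
      · obtain ⟨⟨hsub, hcard⟩, hdis⟩ := mem_matchings.1 hM
        exact mem_matchings.2 ⟨⟨hsub.trans (Finset.subset_insert _ _), hcard⟩, hdis⟩
      · exact pair_mem_matchings (Finset.mem_insert_self _ _) (Finset.mem_insert_of_mem hg) hfg
  rw [h, Finset.card_union_of_disjoint, Finset.card_image_of_injOn]
  · intro g hg g' hg' hgg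
    have hgE := (Finset.mem_filter.1 hg).1
    have hmem : g ∈ ({f, g'} : Finset (Sym2 V)) := by
      rw [← show ({f, g} : Finset (Sym2 V)) = {f, g'} from hgg]; simp
    simp only [Finset.mem_insert, Finset.mem_singleton] at hmem
    rcases hmem with rfl | rfl
    · exact absurd hgE hf
    · rfl
  · rw [Finset.disjoint_left]
    intro M hM hM'
    obtain ⟨g, -, rfl⟩ := Finset.mem_image.1 hM'
    exact hf ((mem_matchings.1 hM).1.1 (Finset.mem_insert_self _ _))

/-- Double counting: each 2-matching is seen once from each of its two edges. -/
theorem sum_card_nonincident (E : Finset (Sym2 V)) :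
    ∑ e ∈ E, (E.filter (Nonincident e)).card = 2 * (matchings E 2).card := by
  induction E using Finset.induction_on with
  | empty => rfl
  | insert f E hf ih =>
    rw [card_matchings_two_insert hf, Finset.sum_insert hf, Finset.filter_insert,
      if_neg (not_nonincident_self f)]
    have h : ∀ e ∈ E, ((insert f E).filter (Nonincident e)).card =
        (E.filter (Nonincident e)).card + if Nonincident f e then 1 else 0 := by
      intro e _
      rw [Finset.filter_insert]
      by_cases hfe : Nonincident f e
      · rw [if_pos (nonincident_comm.1 hfe), if_pos hfe, Finset.card_insert_of_notMem]
        exact fun hm => hf (Finset.mem_filter.1 hm).1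
      · rw [if_neg (fun h => hfe (nonincident_comm.1 h)), if_neg hfe, add_zero]
    rw [Finset.sum_congr rfl h, Finset.sum_add_distrib, ih, ← Finset.card_filter]
    ring

theorem exists_card_nonincident_le_one {E : Finset (Sym2 V)}
    (h : (matchings E 2).card < E.card) :
    ∃ e ∈ E, (E.filter (Nonincident e)).card ≤ 1 := by
  by_contra! hcon
  have h1 : ∑ _e ∈ E, 2 ≤ ∑ e ∈ E, (E.filter (Nonincident e)).card :=
    Finset.sum_le_sum fun e he => hcon e he
  rw [sum_card_nonincident, Finset.sum_const, smul_eq_mul] at h1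
  omega

/-- Every edge contains `x` or `y`, so by pigeonhole two of any three edges share a center. -/
theorem matchings_doubleStar_eq_empty (x y : V) (A B : Finset V) {k : ℕ} (hk : 3 ≤ k) :
    matchings (doubleStar x y A B) k = ∅ := by
  rw [Finset.eq_empty_iff_forall_notMem]
  intro M hM
  obtain ⟨⟨hsub, hcard⟩, hdis⟩ := mem_matchings.1 hM
  obtain ⟨e, he, f, hf, hne, hef⟩ := Finset.exists_ne_map_eq_of_card_lt_of_maps_to
    (s := M) (t := (Finset.univ : Finset Bool)) (f := fun e => decide (x ∈ e))
    (by simp; omega) (fun _ _ => Finset.mem_univ _)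
  have hiff : x ∈ e ↔ x ∈ f := by simpa using hef
  by_cases hx : x ∈ e
  · exact hdis e he f hf hne x ⟨hx, hiff.1 hx⟩
  · exact hdis e he f hf hne y
      ⟨(left_or_right_mem_of_mem_doubleStar (hsub he)).resolve_left hx,
        (left_or_right_mem_of_mem_doubleStar (hsub hf)).resolve_left (fun h => hx (hiff.2 h))⟩

theorem filter_nonincident_doubleStar {x y z w : V} (A B : Finset V)
    (hxz : x ≠ z) (hxw : x ≠ w) (hyz : y ≠ z) (hyw : y ≠ w) :
    (doubleStar x y A B).filter (Nonincident s(z, w)) =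
      doubleStar x y (A \ {z, w}) (B \ {z, w}) := by
  ext e
  simp only [Finset.mem_filter, mem_doubleStar, Finset.mem_sdiff, Finset.mem_insert,
    Finset.mem_singleton, not_or]
  constructor
  · rintro ⟨rfl | ⟨p, hp, rfl⟩ | ⟨p, hp, rfl⟩, he⟩
    · exact Or.inl rfl
    · rw [nonincident_mk] at he
      exact Or.inr (Or.inl ⟨p, ⟨hp, he.1.2.symm, he.2.2.symm⟩, rfl⟩)
    · rw [nonincident_mk] at he
      exact Or.inr (Or.inr ⟨p, ⟨hp, he.1.2.symm, he.2.2.symm⟩, rfl⟩)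
  · rintro (rfl | ⟨p, ⟨hp, h1, h2⟩, rfl⟩ | ⟨p, ⟨hp, h1, h2⟩, rfl⟩)
    · exact ⟨Or.inl rfl, nonincident_mk.2 ⟨⟨hxz.symm, hyz.symm⟩, hxw.symm, hyw.symm⟩⟩
    · exact ⟨Or.inr (Or.inl ⟨p, hp, rfl⟩),
        nonincident_mk.2 ⟨⟨hxz.symm, Ne.symm h1⟩, hxw.symm, Ne.symm h2⟩⟩
    · exact ⟨Or.inr (Or.inr ⟨p, hp, rfl⟩),
        nonincident_mk.2 ⟨⟨hyz.symm, Ne.symm h1⟩, hyw.symm, Ne.symm h2⟩⟩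

/-- The edge `xy` meets all others, so a 2-matching consists of one leaf edge at each center, with
different leaves. The excluded pairs are the diagonal of `A × B`, a copy of `A ∩ B`. -/
theorem IsDoubleStar.card_matchings_two {x y : V} {A B : Finset V} (h : IsDoubleStar x y A B) :
    (matchings (doubleStar x y A B) 2).card + (A ∩ B).card = A.card * B.card := by
  have key : matchings (doubleStar x y A B) 2 =
      ((A ×ˢ B).filter fun p => ¬ p.1 = p.2).image (fun p => {s(x, p.1), s(y, p.2)}) := by
    ext M
    simp only [Finset.mem_image, Finset.mem_filter, Finset.mem_product, Prod.exists]
    constructor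
    · intro hM
      obtain ⟨⟨hsub, hcard⟩, hdis⟩ := mem_matchings.1 hM
      obtain ⟨e, f, hne, rfl⟩ := Finset.card_eq_two.1 hcard
      have hef : Nonincident e f := hdis e (by simp) f (by simp) hne
      have he := mem_doubleStar.1 (hsub (show e ∈ ({e, f} : Finset _) by simp))
      have hf := mem_doubleStar.1 (hsub (show f ∈ ({e, f} : Finset _) by simp))
      rcases he with rfl | ⟨p, hp, rfl⟩ | ⟨p, hp, rfl⟩ <;>
        rcases hf with rfl | ⟨q, hq, rfl⟩ | ⟨q, hq, rfl⟩ <;>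
        simp only [nonincident_mk, ne_eq, not_true_eq_false, false_and, and_false] at hef
      · exact ⟨p, q, ⟨⟨hp, hq⟩, hef.2.2⟩, rfl⟩
      · exact ⟨q, p, ⟨⟨hq, hp⟩, Ne.symm hef.2.2⟩, Finset.pair_comm _ _⟩
    · rintro ⟨p, q, ⟨⟨hp, hq⟩, hpq⟩, rfl⟩
      refine pair_mem_matchings (mem_doubleStar.2 (Or.inr (Or.inl ⟨p, hp, rfl⟩)))
        (mem_doubleStar.2 (Or.inr (Or.inr ⟨q, hq, rfl⟩))) (nonincident_mk.2 ?_)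
      refine ⟨⟨h.ne, ?_⟩, ?_, hpq⟩
      · rintro rfl; exact h.left_notMem_right hq
      · rintro rfl; exact h.right_notMem_left hp
  have hdiag : ((A ×ˢ B).filter fun p => p.1 = p.2).card = (A ∩ B).card := by
    symm
    refine Finset.card_bij (fun p _ => (p, p)) ?_ ?_ ?_
    · intro p hp
      simpa using hp
    · intro p _ q _ hpq
      exact (Prod.ext_iff.1 hpq).1
    · rintro ⟨p, q⟩ hpq
      simp only [Finset.mem_filter, Finset.mem_product] at hpq
      obtain ⟨⟨hp, hq⟩, rfl⟩ := hpq
      exact ⟨p, Finset.mem_inter.2 ⟨hp, hq⟩, rfl⟩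
  rw [key, Finset.card_image_of_injOn, ← hdiag, add_comm,
    Finset.card_filter_add_card_filter_not, Finset.card_product]
  rintro ⟨p, q⟩ hpq ⟨p', q'⟩ hpq' heq
  simp only [Finset.coe_filter, Finset.mem_product, Set.mem_ofPred_eq] at hpq hpq'
  have hx : ∀ r ∈ B, s(y, r) ≠ s(x, p) := by
    intro r hr hrp
    have : x ∈ s(y, r) := by rw [hrp]; simp
    rcases Sym2.mem_iff.1 this with h' | rfl
    · exact h.ne h'
    · exact h.left_notMem_right hr
  have hy : ∀ r ∈ A, s(x, r) ≠ s(y, q) := by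
    intro r hr hrp
    have : y ∈ s(x, r) := by rw [hrp]; simp
    rcases Sym2.mem_iff.1 this with h' | rfl
    · exact h.ne h'.symm
    · exact h.right_notMem_left hr
  have heq' : ({s(x, p), s(y, q)} : Finset (Sym2 V)) = {s(x, p'), s(y, q')} := heq
  have h1 : s(x, p) ∈ ({s(x, p'), s(y, q')} : Finset (Sym2 V)) := by rw [← heq']; simp
  have h2 : s(y, q) ∈ ({s(x, p'), s(y, q')} : Finset (Sym2 V)) := by rw [← heq']; simp
  simp only [Finset.mem_insert, Finset.mem_singleton] at h1 h2
  exact Prod.ext (Sym2.congr_right.1 (h1.resolve_right fun h => hx _ hpq'.1.2 h.symm))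
    (Sym2.congr_right.1 (h2.resolve_left fun h => hy _ hpq'.1.1 h.symm))

/-- Take for `A` and `B` the remaining neighbors of `x` and of `y`. -/
theorem exists_filter_incident_eq_doubleStar {E : Finset (Sym2 V)} (hE : ∀ e ∈ E, ¬ e.IsDiag)
    {x y : V} (hxy : s(x, y) ∈ E) :
    ∃ A B, IsDoubleStar x y A B ∧
      E.filter (fun e => ¬ Nonincident s(x, y) e) = doubleStar x y A B := by
  have hne : x ≠ y := fun h => hE _ hxy (Sym2.mk_isDiag_iff.2 h)
  have hxx : ∀ v, s(v, v) ∉ E := fun v hv => hE _ hv (Sym2.mk_isDiag_iff.2 rfl)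
  refine ⟨Finset.univ.filter fun p => s(x, p) ∈ E ∧ p ≠ y,
    Finset.univ.filter fun p => s(y, p) ∈ E ∧ p ≠ x,
    ⟨hne, by simp [hxx], by simp, by simp, by simp [hxx]⟩, ?_⟩
  ext e
  simp only [Finset.mem_filter, mem_doubleStar, Finset.mem_univ, true_and]
  constructor
  · induction e with
    | _ z w =>
    rw [nonincident_mk]
    rintro ⟨hzw, hn⟩
    by_cases hxz : x = z
    · subst hxz
      by_cases hwy : w = y
      · exact Or.inl (by rw [hwy])
      · exact Or.inr (Or.inl ⟨w, ⟨hzw, hwy⟩, rfl⟩)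
    by_cases hxw : x = w
    · subst hxw
      rw [Sym2.eq_swap] at hzw ⊢
      by_cases hwy : z = y
      · exact Or.inl (by rw [hwy])
      · exact Or.inr (Or.inl ⟨z, ⟨hzw, hwy⟩, rfl⟩)
    by_cases hyz : y = z
    · subst hyz
      exact Or.inr (Or.inr ⟨w, ⟨hzw, Ne.symm hxw⟩, rfl⟩)
    by_cases hyw : y = w
    · subst hyw
      rw [Sym2.eq_swap] at hzw ⊢
      exact Or.inr (Or.inr ⟨z, ⟨hzw, Ne.symm hxz⟩, rfl⟩)
    exact absurd ⟨⟨hxz, hxw⟩, hyz, hyw⟩ hn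
  · rintro (rfl | ⟨p, ⟨hp, -⟩, rfl⟩ | ⟨p, ⟨hp, -⟩, rfl⟩)
    · exact ⟨hxy, not_nonincident_self _⟩
    · exact ⟨hp, fun h => h x ⟨by simp, by simp⟩⟩
    · exact ⟨hp, fun h => h y ⟨by simp, by simp⟩⟩

/-- A graph with fewer `2`-matchings than edges is a double star with at most one edge added. -/
theorem exists_eq_doubleStar {E : Finset (Sym2 V)} (hE : ∀ e ∈ E, ¬ e.IsDiag)
    (h : (matchings E 2).card < E.card) :
    ∃ x y A B, IsDoubleStar x y A B ∧ A.card ≤ B.card ∧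
      (E = doubleStar x y A B ∨
        ∃ z w, z ≠ w ∧ (x ≠ z ∧ x ≠ w) ∧ (y ≠ z ∧ y ≠ w) ∧
          E = insert s(z, w) (doubleStar x y A B)) := by
  obtain ⟨e, he, hcard⟩ := exists_card_nonincident_le_one h
  induction e with
  | _ x y =>
  obtain ⟨A, B, hAB, hEAB⟩ := exists_filter_incident_eq_doubleStar hE he
  have hsplit := Finset.filter_union_filter_not_eq (Nonincident s(x, y)) E
  have main : E = doubleStar x y A B ∨
        ∃ z w, z ≠ w ∧ (x ≠ z ∧ x ≠ w) ∧ (y ≠ z ∧ y ≠ w) ∧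
          E = insert s(z, w) (doubleStar x y A B) := by
    rcases Nat.le_one_iff_eq_zero_or_eq_one.1 hcard with h0 | h1
    · left
      rw [Finset.card_eq_zero.1 h0, hEAB, Finset.empty_union] at hsplit
      exact hsplit.symm
    · right
      obtain ⟨f, hf⟩ := Finset.card_eq_one.1 h1
      have hfm : f ∈ E.filter (Nonincident s(x, y)) := by rw [hf]; simp
      obtain ⟨hfE, hfn⟩ := Finset.mem_filter.1 hfm
      induction f with
      | _ z w =>
      rw [nonincident_mk] at hfn
      refine ⟨z, w, fun h => hE _ hfE (Sym2.mk_isDiag_iff.2 h), hfn.1, hfn.2, ?_⟩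
      rw [hf, hEAB] at hsplit
      rw [← hsplit, Finset.insert_eq]
  -- The two centers play symmetric roles, so the smaller leaf set may be put first.
  rcases le_total A.card B.card with hle | hle
  · exact ⟨x, y, A, B, hAB, hle, main⟩
  · refine ⟨y, x, B, A, hAB.symm, hle, ?_⟩
    rw [doubleStar_symm y x B A]
    rcases main with h | ⟨z, w, h1, h2, h3, h4⟩
    · exact Or.inl h
    · exact Or.inr ⟨z, w, h1, h3, h2, h4⟩

/-- The number of `2`-matchings of a double star with one edge added. -/
theorem IsDoubleStar.card_matchings_two_insert {x y z w : V} {A B : Finset V}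
    (h : IsDoubleStar x y A B) (hxz : x ≠ z) (hxw : x ≠ w) (hyz : y ≠ z) (hyw : y ≠ w) :
    (matchings (insert s(z, w) (doubleStar x y A B)) 2).card + (A ∩ B).card +
      (A ∩ {z, w}).card + (B ∩ {z, w}).card = A.card * B.card + A.card + B.card + 1 := by
  -- The new 2-matchings pair `zw` with the edges of the double star left after deleting the leaves
  -- `z` and `w`.
  rw [_root_.card_matchings_two_insert (notMem_doubleStar hxz hxw hyz hyw),
    filter_nonincident_doubleStar A B hxz hxw hyz hyw,
    (h.mono Finset.sdiff_subset Finset.sdiff_subset).card]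
  have h1 := h.card_matchings_two
  have h2 := Finset.card_sdiff_add_card_inter A {z, w}
  have h3 := Finset.card_sdiff_add_card_inter B {z, w}
  omega

end Matchings

/-! ### The matching polynomial and the matching numbers -/

section MatchingPolynomial

theorem matchingNumber_eq_zero {V : Type*} [Fintype V] (G : SimpleGraph V) {k : ℕ}
    (hk : Fintype.card V < 2 * k) : matchingNumber G k = 0 := by
  classical
  rw [matchingNumber_eq_card (G.coe_edgeFinset), Finset.card_eq_zero,
    Finset.eq_empty_iff_forall_notMem]
  intro M hM
  obtain ⟨⟨hsub, hcard⟩, hdis⟩ := mem_matchings.1 hM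
  have h1 : (M.biUnion Sym2.toFinset).card = ∑ e ∈ M, e.toFinset.card := by
    refine Finset.card_biUnion fun e he f hf hne => Finset.disjoint_left.2 ?_
    intro v hv hv'
    exact hdis e he f hf hne v ⟨Sym2.mem_toFinset.1 hv, Sym2.mem_toFinset.1 hv'⟩
  have h2 : ∑ e ∈ M, e.toFinset.card = ∑ _e ∈ M, 2 :=
    Finset.sum_congr rfl fun e he => Sym2.card_toFinset_of_not_isDiag e
      (G.not_isDiag_of_mem_edgeSet (SimpleGraph.mem_edgeFinset.1 (hsub he)))
  rw [h2, Finset.sum_const, smul_eq_mul, hcard] at h1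
  have h3 := Finset.card_le_univ (M.biUnion Sym2.toFinset)
  omega

theorem matchingPolynomial_coeff {V : Type*} [Fintype V] (G : SimpleGraph V) {k : ℕ}
    (hk : 2 * k ≤ Fintype.card V) :
    (matchingPolynomial G).coeff (Fintype.card V - 2 * k) = (-1) ^ k * matchingNumber G k := by
  rw [matchingPolynomial, finsetSum_coeff, Finset.sum_eq_single k]
  · rw [coeff_C_mul, coeff_X_pow, if_pos rfl, mul_one]
  · intro j hj hjk
    rw [coeff_C_mul, coeff_X_pow, if_neg, mul_zero]
    have := Finset.mem_range.1 hj
    omega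
  · intro h
    exact absurd (Finset.mem_range.2 (by omega)) h

theorem matchingNumber_zero {V : Type*} [Fintype V] (G : SimpleGraph V) :
    matchingNumber G 0 = 1 := by
  classical
  rw [matchingNumber_eq_card (G.coe_edgeFinset), card_matchings_zero]

theorem natDegree_matchingPolynomial {V : Type*} [Fintype V] (G : SimpleGraph V) :
    (matchingPolynomial G).natDegree = Fintype.card V := by
  refine le_antisymm ?_ (le_natDegree_of_ne_zero ?_)
  · refine natDegree_sum_le_of_forall_le _ _ fun k _ => ?_
    exact (natDegree_C_mul_X_pow_le _ _).trans (Nat.sub_le _ _)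
  · have h := matchingPolynomial_coeff G (k := 0) (by omega)
    rw [mul_zero, Nat.sub_zero, matchingNumber_zero] at h
    simp [h]

/-- The degree recovers the order because `m(G, 0) = 1`; the coefficients then give `m(G, k)` for
`2k ≤ n`, and the other matching numbers vanish. -/
theorem matchingPolynomial_eq_iff {V W : Type*} [Fintype V] [Fintype W] {G : SimpleGraph V}
    {H : SimpleGraph W} :
    matchingPolynomial G = matchingPolynomial H ↔
      Fintype.card V = Fintype.card W ∧ ∀ k, matchingNumber G k = matchingNumber H k := by
  constructor
  · intro h
    have hc : Fintype.card V = Fintype.card W := by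
      rw [← natDegree_matchingPolynomial G, h, natDegree_matchingPolynomial]
    refine ⟨hc, fun k => ?_⟩
    by_cases hk : 2 * k ≤ Fintype.card V
    · have h1 := matchingPolynomial_coeff G hk
      rw [h, hc, matchingPolynomial_coeff H (hc ▸ hk)] at h1
      have h2 := mul_left_cancel₀ (pow_ne_zero k (by norm_num : (-1 : ℤ) ≠ 0)) h1
      exact_mod_cast h2.symm
    · rw [matchingNumber_eq_zero G (by omega), matchingNumber_eq_zero H (by omega)]
  · rintro ⟨hc, h⟩
    simp only [matchingPolynomial, hc, h]

end MatchingPolynomial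

/-! ### Recognizing isomorphisms by counting edges -/

section Isomorphism

/-- One inclusion of edge sets suffices, since finite sets of equal size cannot be properly nested.
-/
theorem nonempty_iso_of_adj {V W : Type*} [Fintype V] [Fintype W] {G : SimpleGraph V}
    {H : SimpleGraph W} [Fintype G.edgeSet] [Fintype H.edgeSet] (φ : V ≃ W)
    (hle : ∀ p q, H.Adj p q → G.Adj (φ.symm p) (φ.symm q))
    (hcard : G.edgeFinset.card = H.edgeFinset.card) : Nonempty (G ≃g H) := by
  classical
  have hHG : H ≤ G.comap φ.symm := fun p q h => hle p q h
  have hiso : G.comap φ.symm ≃g G := SimpleGraph.Iso.comap φ.symm G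
  have heq : H = G.comap φ.symm := by
    rw [← SimpleGraph.edgeFinset_inj]
    refine Finset.eq_of_subset_of_card_le (SimpleGraph.edgeFinset_mono hHG) ?_
    rw [hiso.card_edgeFinset_eq, hcard]
  rw [heq]
  exact ⟨hiso.symm⟩

theorem exists_kVertex_equiv {W : Type*} [Fintype W] {t : ℕ} (hW : Fintype.card W = t + 3)
    {u l c : W} (hul : u ≠ l) (huc : u ≠ c) (hlc : l ≠ c) :
    ∃ φ : KVertex 1 t ≃ W,
      φ (Sum.inl true) = u ∧ φ (Sum.inl false) = c ∧ φ (Sum.inr (Sum.inl 0)) = l := by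
  classical
  -- Only the values at the three marked vertices are prescribed; `l` on the others is a default
  -- value.
  let f : KVertex 1 t → W
    | Sum.inl true => u
    | Sum.inl false => c
    | Sum.inr _ => l
  obtain ⟨g, hg⟩ := Finset.exists_equiv_extend_of_card_eq (t := (Finset.univ : Finset W))
    (α := KVertex 1 t) (by simp [hW]; omega)
    (s := {Sum.inl true, Sum.inl false, Sum.inr (Sum.inl 0)}) (f := f)
    (Finset.subset_univ _) (by
      intro a ha b hb hab
      simp only [Finset.coe_insert, Finset.coe_singleton, Set.mem_insert_iff,
        Set.mem_singleton_iff] at ha hb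
      rcases ha with rfl | rfl | rfl <;> rcases hb with rfl | rfl | rfl <;>
        simp_all [f, eq_comm])
  refine ⟨g.trans (Equiv.subtypeUnivEquiv fun _ => Finset.mem_univ _), ?_, ?_, ?_⟩
  · exact hg _ (by simp)
  · exact hg _ (by simp)
  · exact hg _ (by simp)

end Isomorphism

/-! ### `S(t)` and `S'(t)` as double stars -/

section SpecialGraphs

/-- The vertices of `t K₁` in `K(1, t; 1)`. -/
def pendants (t : ℕ) : Finset (KVertex 1 t) :=
  Finset.univ.image (Sum.inr ∘ Sum.inr)

theorem card_pendants (t : ℕ) : (pendants t).card = t := by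
  rw [pendants, Finset.card_image_of_injective _ (Sum.inr_injective.comp Sum.inr_injective),
    Finset.card_univ, Fintype.card_fin]

theorem mem_pendants {t : ℕ} {v : KVertex 1 t} :
    v ∈ pendants t ↔ ∃ j, v = Sum.inr (Sum.inr j) := by
  simp [pendants, eq_comm]

theorem SGraph_adj_leaf_center (t : ℕ) :
    (SGraph t).Adj (Sum.inr (Sum.inl 0)) (Sum.inl false) := by
  simp [SGraph, KGraph, KRel]

theorem SGraph_adj {t : ℕ} {p : KVertex 1 t} (hu : p ≠ Sum.inl true) (hc : p ≠ Sum.inl false) :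
    (SGraph t).Adj (Sum.inl true) p := by
  rcases p with (_ | _) | p | p <;> simp_all [SGraph, KGraph, KRel]

theorem SGraph'_adj_leaf_center (t : ℕ) :
    (SGraph' t).Adj (Sum.inr (Sum.inl 0)) (Sum.inl false) :=
  Or.inl (SGraph_adj_leaf_center t)

theorem SGraph'_adj {t : ℕ} {p : KVertex 1 t} (hu : p ≠ Sum.inl true) :
    (SGraph' t).Adj (Sum.inl true) p := by
  by_cases hc : p = Sum.inl false
  · subst hc
    simp [SGraph', KGraph', SimpleGraph.edge_adj]
  · exact Or.inl (SGraph_adj hu hc)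

/-- The middle edge joins `u` to the leaf of the star. The star's center thus becomes a leaf of the
second center, and in `S'(t)` a common leaf of both. -/
theorem isDoubleStar_SGraph (t : ℕ) :
    IsDoubleStar (Sum.inl true) (Sum.inr (Sum.inl 0)) (pendants t) {Sum.inl false} := by
  constructor <;> simp [mem_pendants]

theorem isDoubleStar_SGraph' (t : ℕ) :
    IsDoubleStar (Sum.inl true) (Sum.inr (Sum.inl 0))
      (insert (Sum.inl false) (pendants t)) {Sum.inl false} := by
  constructor <;> simp [mem_pendants]

theorem coe_doubleStar_SGraph (t : ℕ) :
    (doubleStar (Sum.inl true) (Sum.inr (Sum.inl 0)) (pendants t) {Sum.inl false} :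
      Set (Sym2 (KVertex 1 t))) = (SGraph t).edgeSet := by
  ext e
  rw [Finset.mem_coe, mem_doubleStar]
  constructor
  · rintro (rfl | ⟨p, hp, rfl⟩ | ⟨p, hp, rfl⟩)
    · exact SGraph_adj (by simp) (by simp)
    · obtain ⟨j, rfl⟩ := mem_pendants.1 hp
      exact SGraph_adj (by simp) (by simp)
    · rw [Finset.mem_singleton.1 hp]
      exact SGraph_adj_leaf_center t
  · induction e with
    | _ p q =>
    rw [SimpleGraph.mem_edgeSet]
    rcases p with (_ | _) | p | p <;> rcases q with (_ | _) | q | q <;>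
      simp [SGraph, KGraph, KRel, mem_pendants, Fin.fin_one_eq_zero]

theorem coe_doubleStar_SGraph' (t : ℕ) :
    (doubleStar (Sum.inl true) (Sum.inr (Sum.inl 0))
      (insert (Sum.inl false) (pendants t)) {Sum.inl false} :
      Set (Sym2 (KVertex 1 t))) = (SGraph' t).edgeSet := by
  ext e
  rw [Finset.mem_coe, SGraph', KGraph', SimpleGraph.edgeSet_sup, SimpleGraph.edgeSet_edge_of_ne
    (by simp), Set.mem_union, Set.mem_singleton_iff, ← SGraph, ← coe_doubleStar_SGraph,
    Finset.mem_coe, mem_doubleStar, mem_doubleStar, Finset.exists_mem_insert]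
  grind

theorem matchingNumber_SGraph (t : ℕ) :
    matchingNumber (SGraph t) 1 = t + 2 ∧ matchingNumber (SGraph t) 2 = t ∧
      ∀ k, 3 ≤ k → matchingNumber (SGraph t) k = 0 := by
  have h := isDoubleStar_SGraph t
  refine ⟨?_, ?_, fun k hk => ?_⟩ <;> rw [matchingNumber_eq_card (coe_doubleStar_SGraph t)]
  · rw [card_matchings_one, h.card, card_pendants, Finset.card_singleton]
  · have h2 := h.card_matchings_two
    rw [card_pendants, Finset.card_singleton, Finset.inter_singleton_of_notMem
      (by simp [mem_pendants]), Finset.card_empty] at h2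
    omega
  · rw [matchings_doubleStar_eq_empty _ _ _ _ hk, Finset.card_empty]

theorem matchingNumber_SGraph' (t : ℕ) :
    matchingNumber (SGraph' t) 1 = t + 3 ∧ matchingNumber (SGraph' t) 2 = t ∧
      ∀ k, 3 ≤ k → matchingNumber (SGraph' t) k = 0 := by
  have h := isDoubleStar_SGraph' t
  have hc : (insert (Sum.inl false) (pendants t)).card = t + 1 := by
    rw [Finset.card_insert_of_notMem (by simp [mem_pendants]), card_pendants]
  refine ⟨?_, ?_, fun k hk => ?_⟩ <;> rw [matchingNumber_eq_card (coe_doubleStar_SGraph' t)]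
  · rw [card_matchings_one, h.card, hc, Finset.card_singleton]
  · have h2 := h.card_matchings_two
    rw [hc, Finset.card_singleton, Finset.inter_singleton_of_mem (by simp),
      Finset.card_singleton] at h2
    omega
  · rw [matchings_doubleStar_eq_empty _ _ _ _ hk, Finset.card_empty]

theorem matchingNumber_one_eq_card_edgeFinset {V : Type*} [Fintype V] (G : SimpleGraph V)
    [Fintype G.edgeSet] : matchingNumber G 1 = G.edgeFinset.card := by
  classical
  rw [matchingNumber_eq_card G.coe_edgeFinset, card_matchings_one]

theorem nonempty_SGraph_iso {W : Type*} [Fintype W] {H : SimpleGraph W} {t : ℕ}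
    (hW : Fintype.card W = t + 3) (hm : matchingNumber H 1 = t + 2) {u l c : W}
    (hul : u ≠ l) (huc : u ≠ c) (hlc : l ≠ c)
    (h : ∀ e ∈ H.edgeSet, e = s(l, c) ∨ ∃ p, p ≠ u ∧ p ≠ c ∧ e = s(u, p)) :
    Nonempty (SGraph t ≃g H) := by
  classical
  obtain ⟨φ, rfl, rfl, rfl⟩ := exists_kVertex_equiv hW hul huc hlc
  refine nonempty_iso_of_adj φ (fun p q hpq => ?_) ?_
  · rcases h s(p, q) hpq with h | ⟨r, hru, hrc, h⟩
    · rcases Sym2.eq_iff.1 h with ⟨rfl, rfl⟩ | ⟨rfl, rfl⟩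
      · simpa using SGraph_adj_leaf_center t
      · simpa using (SGraph_adj_leaf_center t).symm
    · have h' : (SGraph t).Adj (Sum.inl true) (φ.symm r) :=
        SGraph_adj (by rwa [ne_eq, Equiv.symm_apply_eq]) (by rwa [ne_eq, Equiv.symm_apply_eq])
      rcases Sym2.eq_iff.1 h with ⟨rfl, rfl⟩ | ⟨rfl, rfl⟩
      · simpa using h'
      · simpa using h'.symm
  · rw [← matchingNumber_one_eq_card_edgeFinset, ← matchingNumber_one_eq_card_edgeFinset, hm,
      (matchingNumber_SGraph t).1]

theorem nonempty_SGraph'_iso {W : Type*} [Fintype W] {H : SimpleGraph W} {t : ℕ}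
    (hW : Fintype.card W = t + 3) (hm : matchingNumber H 1 = t + 3) {u l c : W}
    (hul : u ≠ l) (huc : u ≠ c) (hlc : l ≠ c)
    (h : ∀ e ∈ H.edgeSet, e = s(l, c) ∨ ∃ p, p ≠ u ∧ e = s(u, p)) :
    Nonempty (SGraph' t ≃g H) := by
  classical
  obtain ⟨φ, rfl, rfl, rfl⟩ := exists_kVertex_equiv hW hul huc hlc
  refine nonempty_iso_of_adj φ (fun p q hpq => ?_) ?_
  · rcases h s(p, q) hpq with h | ⟨r, hru, h⟩
    · rcases Sym2.eq_iff.1 h with ⟨rfl, rfl⟩ | ⟨rfl, rfl⟩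
      · simpa using SGraph'_adj_leaf_center t
      · simpa using (SGraph'_adj_leaf_center t).symm
    · have h' : (SGraph' t).Adj (Sum.inl true) (φ.symm r) :=
        SGraph'_adj (by rwa [ne_eq, Equiv.symm_apply_eq])
      rcases Sym2.eq_iff.1 h with ⟨rfl, rfl⟩ | ⟨rfl, rfl⟩
      · simpa using h'
      · simpa using h'.symm
  · rw [← matchingNumber_one_eq_card_edgeFinset, ← matchingNumber_one_eq_card_edgeFinset, hm,
      (matchingNumber_SGraph' t).1]

end SpecialGraphs

/-! ### Arithmetic of the leaf counts -/

section Uniqueness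

variable {V : Type*} [DecidableEq V]

theorem card_inter_pair_le (A : Finset V) (z w : V) : (A ∩ {z, w}).card ≤ 2 :=
  (Finset.card_le_card Finset.inter_subset_right).trans Finset.card_le_two

/-- Two distinct vertices, exactly one of which is in `B`. -/
theorem exists_of_card_inter_pair_eq_one {B : Finset V} {z w : V}
    (h : (B ∩ {z, w}).card = 1) :
    (z ∈ B ∧ w ∉ B) ∨ (w ∈ B ∧ z ∉ B) ∨ z = w := by
  by_cases hz : z ∈ B <;> by_cases hw : w ∈ B
  · right; right
    by_contra hne
    rw [Finset.inter_eq_right.2 (by simp [Finset.insert_subset_iff, hz, hw]),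
      Finset.card_pair hne] at h
    omega
  · exact Or.inl ⟨hz, hw⟩
  · exact Or.inr (Or.inl ⟨hw, hz⟩)
  · exfalso
    have : B ∩ {z, w} = ∅ := by
      ext v
      simp only [Finset.mem_inter, Finset.mem_insert, Finset.mem_singleton,
        Finset.notMem_empty, iff_false, not_and, not_or]
      rintro hv
      exact ⟨fun h => hz (h ▸ hv), fun h => hw (h ▸ hv)⟩
    simp [this] at h

/-- The arithmetic behind the uniqueness of `S(t)`, for a double star. -/
theorem le_one_of_card_eq {a b c t : ℕ} (hab : a ≤ b) (hca : c ≤ a) (ht : t ∉ ({2, 3, 4} : Set ℕ))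
    (hm : a + b + 1 = t + 2) (h2 : t + c = a * b) :
    (a = 0 ∧ b = 1) ∨ (a = 1 ∧ c = 0) := by
  simp only [Set.mem_insert_iff, Set.mem_singleton_iff, not_or] at ht
  -- Eliminating `t` gives `(a - 1)(b - 1) = c ≤ a ≤ b`. For `a = 2` this leaves `b = 2` or `b = 3`,
  -- that is, `t = 3` or `t = 4`.
  have ha : a ≤ 2 := by nlinarith
  interval_cases a
  · omega
  · omega
  · omega

/-- Here `c + a' + b' = ab + 1` with left side at most `a + 4`, so `a ≤ 2`. The cases `a = 1` and `a
= 2` give only `t = a + b` in `{2, 3, 4}`. -/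
theorem eq_zero_of_card_eq {a b c a' b' t : ℕ} (hab : a ≤ b) (hca : c ≤ a)
    (ha' : a' ≤ 2) (haa : a' ≤ a) (hb' : b' ≤ 2)
    (ht : t ∉ ({2, 3, 4} : Set ℕ))
    (hm : a + b + 2 = t + 2) (h2 : t + c + a' + b' = a * b + a + b + 1) :
    a = 0 ∧ b' = 1 := by
  simp only [Set.mem_insert_iff, Set.mem_singleton_iff, not_or] at ht
  have ha : a ≤ 2 := by nlinarith
  interval_cases a
  · omega
  · omega
  · omega

/-- Now `(a - 1)(b - 1) = c - 1`, and `a = 2` forces `t = 2`. The bound `b ≤ t + 1` removes `a = 0`,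
`b = 2`, `t = 0`: a star with three edges does not fit on three vertices. -/
theorem le_one_of_card_eq' {a b c t : ℕ} (hab : a ≤ b) (hca : c ≤ a)
    (ht : t ∉ ({2, 3} : Set ℕ)) (hn : b ≤ t + 1)
    (hm : a + b + 1 = t + 3) (h2 : t + c = a * b) :
    a = 1 ∧ c = 1 := by
  simp only [Set.mem_insert_iff, Set.mem_singleton_iff, not_or] at ht
  have ha : a ≤ 2 := by nlinarith
  interval_cases a
  · omega
  · omega
  · omega

/-- Here `c + a' + b' = ab + 2`. The second alternative, with `t = 1`, is a triangle with a pendant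
edge. -/
theorem eq_zero_of_card_eq' {a b c a' b' t : ℕ} (hab : a ≤ b) (hca : c ≤ a)
    (ha' : a' ≤ 2) (haa : a' ≤ a) (hb' : b' ≤ 2) (hbb : b' ≤ b)
    (ht : t ∉ ({2, 3} : Set ℕ))
    (hm : a + b + 2 = t + 3) (h2 : t + c + a' + b' = a * b + a + b + 1) :
    (a = 0 ∧ b' = 2) ∨ (a = 1 ∧ b = 1 ∧ c = 1 ∧ a' = 1 ∧ b' = 1) := by
  simp only [Set.mem_insert_iff, Set.mem_singleton_iff, not_or] at ht
  have ha : a ≤ 2 := by nlinarith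
  interval_cases a
  · omega
  · omega
  · omega

end Uniqueness

/-! ### Identifying the graphs with the given counts -/

theorem nonempty_SGraph_iso_of_matchingNumber {W : Type*} [Fintype W] {H : SimpleGraph W} {t : ℕ}
    (ht : t ∉ ({2, 3, 4} : Set ℕ)) (hW : Fintype.card W = t + 3)
    (hm : matchingNumber H 1 = t + 2) (h2 : matchingNumber H 2 = t) :
    Nonempty (SGraph t ≃g H) := by
  classical
  have hmE := hm
  have hE : ∀ e ∈ H.edgeFinset, ¬ e.IsDiag := fun e he =>
    H.not_isDiag_of_mem_edgeSet (SimpleGraph.mem_edgeFinset.1 he)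
  rw [matchingNumber_one_eq_card_edgeFinset] at hmE
  rw [matchingNumber_eq_card H.coe_edgeFinset] at h2
  obtain ⟨x, y, A, B, hAB, hle, hcase⟩ := exists_eq_doubleStar hE (by omega)
  have hca : (A ∩ B).card ≤ A.card := Finset.card_le_card Finset.inter_subset_left
  rcases hcase with heq | ⟨z, w, hzw, ⟨hxz, hxw⟩, ⟨hyz, hyw⟩, heq⟩
  · have hE2 := hAB.card_matchings_two
    rw [← heq, h2] at hE2
    have hE1 := hAB.card
    rw [← heq, hmE] at hE1
    rcases le_one_of_card_eq hle hca ht hE1.symm hE2 with ⟨ha, hb⟩ | ⟨ha, hc⟩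
    · obtain ⟨q, rfl⟩ := Finset.card_eq_one.1 hb
      have hqx : q ≠ x := fun h => hAB.left_notMem_right (by simp [h])
      have hqy : q ≠ y := fun h => hAB.right_notMem_right (by simp [h])
      -- The edges form the path `x, y, q`, which is `S(0)`.
      refine nonempty_SGraph_iso hW hm (u := x) (l := y) (c := q) hAB.ne hqx.symm hqy.symm ?_
      intro e he
      rw [← SimpleGraph.mem_edgeFinset, heq, mem_doubleStar, Finset.card_eq_zero.1 ha] at he
      rcases he with rfl | ⟨p, hp, rfl⟩ | ⟨p, hp, rfl⟩
      · exact Or.inr ⟨y, hAB.ne.symm, hqy.symm, rfl⟩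
      · simp at hp
      · rw [Finset.mem_singleton.1 hp]
        exact Or.inl rfl
    · obtain ⟨p, rfl⟩ := Finset.card_eq_one.1 ha
      have hpx : p ≠ x := fun h => hAB.left_notMem_left (by simp [h])
      have hpy : p ≠ y := fun h => hAB.right_notMem_left (by simp [h])
      have hpB : p ∉ B := fun h => by simp [h] at hc
      refine nonempty_SGraph_iso hW hm (u := y) (l := x) (c := p) hAB.ne.symm hpy.symm
        hpx.symm ?_
      intro e he
      rw [← SimpleGraph.mem_edgeFinset, heq, mem_doubleStar] at he
      rcases he with rfl | ⟨q, hq, rfl⟩ | ⟨q, hq, rfl⟩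
      · exact Or.inr ⟨x, hAB.ne, hpx.symm, Sym2.eq_swap⟩
      · rw [Finset.mem_singleton.1 hq]
        exact Or.inl rfl
      · exact Or.inr ⟨q, fun h => hAB.right_notMem_right (h ▸ hq), fun h => hpB (h ▸ hq), rfl⟩
  · have hE2 := hAB.card_matchings_two_insert hxz hxw hyz hyw
    rw [← heq, h2] at hE2
    have hE1 := Finset.card_insert_of_notMem (notMem_doubleStar (A := A) (B := B) hxz hxw hyz hyw)
    rw [← heq, hmE, hAB.card] at hE1
    obtain ⟨ha, hb'⟩ := eq_zero_of_card_eq hle hca (card_inter_pair_le A z w)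
      (Finset.card_le_card Finset.inter_subset_left) (card_inter_pair_le B z w) ht
      hE1.symm hE2
    -- Since `A` is empty, the double star is a star at `y`. The end of `zw` outside `B` becomes the
    -- center `c`, the other end the leaf `l`.
    have key : ∀ l c, y ≠ l → y ≠ c → l ≠ c → x ≠ c → c ∉ B → s(z, w) = s(l, c) →
        Nonempty (SGraph t ≃g H) := by
      intro l c hyl hyc hlc hxc hcB hs
      refine nonempty_SGraph_iso hW hm hyl hyc hlc ?_
      intro e he
      rw [← SimpleGraph.mem_edgeFinset, heq, Finset.mem_insert, mem_doubleStar,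
        Finset.card_eq_zero.1 ha, hs] at he
      rcases he with rfl | rfl | ⟨p, hp, rfl⟩ | ⟨p, hp, rfl⟩
      · exact Or.inl rfl
      · exact Or.inr ⟨x, hAB.ne, hxc, Sym2.eq_swap⟩
      · simp at hp
      · exact Or.inr ⟨p, fun h => hAB.right_notMem_right (h ▸ hp), fun h => hcB (h ▸ hp), rfl⟩
    rcases exists_of_card_inter_pair_eq_one hb' with ⟨-, hw⟩ | ⟨-, hz⟩ | h
    · exact key z w hyz hyw hzw hxw hw rfl
    · exact key w z hyw hyz hzw.symm hxz hz Sym2.eq_swap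
    · exact absurd h hzw

theorem nonempty_SGraph'_iso_of_matchingNumber {W : Type*} [Fintype W] {H : SimpleGraph W} {t : ℕ}
    (ht : t ∉ ({2, 3} : Set ℕ)) (hW : Fintype.card W = t + 3)
    (hm : matchingNumber H 1 = t + 3) (h2 : matchingNumber H 2 = t) :
    Nonempty (SGraph' t ≃g H) := by
  classical
  have hmE := hm
  have hE : ∀ e ∈ H.edgeFinset, ¬ e.IsDiag := fun e he =>
    H.not_isDiag_of_mem_edgeSet (SimpleGraph.mem_edgeFinset.1 he)
  rw [matchingNumber_one_eq_card_edgeFinset] at hmE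
  rw [matchingNumber_eq_card H.coe_edgeFinset] at h2
  obtain ⟨x, y, A, B, hAB, hle, hcase⟩ := exists_eq_doubleStar hE (by omega)
  have hca : (A ∩ B).card ≤ A.card := Finset.card_le_card Finset.inter_subset_left
  rcases hcase with heq | ⟨z, w, hzw, ⟨hxz, hxw⟩, ⟨hyz, hyw⟩, heq⟩
  · have hE2 := hAB.card_matchings_two
    rw [← heq, h2] at hE2
    have hE1 := hAB.card
    rw [← heq, hmE] at hE1
    have hB : B.card ≤ t + 1 := by
      have h := Finset.card_le_univ (insert x (insert y B))
      rw [Finset.card_insert_of_notMem (by simp [hAB.ne, hAB.left_notMem_right]),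
        Finset.card_insert_of_notMem hAB.right_notMem_right, hW] at h
      omega
    obtain ⟨ha, hc⟩ := le_one_of_card_eq' hle hca ht hB hE1.symm hE2
    obtain ⟨p, rfl⟩ := Finset.card_eq_one.1 ha
    have hpx : p ≠ x := fun h => hAB.left_notMem_left (by simp [h])
    have hpy : p ≠ y := fun h => hAB.right_notMem_left (by simp [h])
    refine nonempty_SGraph'_iso hW hm (u := y) (l := x) (c := p) hAB.ne.symm hpy.symm
      hpx.symm ?_
    intro e he
    rw [← SimpleGraph.mem_edgeFinset, heq, mem_doubleStar] at he
    rcases he with rfl | ⟨q, hq, rfl⟩ | ⟨q, hq, rfl⟩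
    · exact Or.inr ⟨x, hAB.ne, Sym2.eq_swap⟩
    · rw [Finset.mem_singleton.1 hq]
      exact Or.inl rfl
    · exact Or.inr ⟨q, fun h => hAB.right_notMem_right (h ▸ hq), rfl⟩
  · have hE2 := hAB.card_matchings_two_insert hxz hxw hyz hyw
    rw [← heq, h2] at hE2
    have hE1 := Finset.card_insert_of_notMem (notMem_doubleStar (A := A) (B := B) hxz hxw hyz hyw)
    rw [← heq, hmE, hAB.card] at hE1
    rcases eq_zero_of_card_eq' hle hca (card_inter_pair_le A z w)
      (Finset.card_le_card Finset.inter_subset_left) (card_inter_pair_le B z w)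
      (Finset.card_le_card Finset.inter_subset_left) ht hE1.symm hE2 with
      ⟨ha, -⟩ | ⟨ha, hb, hc, ha', -⟩
    -- A star at `y` with both ends of `zw` among its leaves: `zw` closes the triangle.
    · refine nonempty_SGraph'_iso hW hm hyz hyw hzw ?_
      intro e he
      rw [← SimpleGraph.mem_edgeFinset, heq, Finset.mem_insert, mem_doubleStar,
        Finset.card_eq_zero.1 ha] at he
      rcases he with rfl | rfl | ⟨p, hp, rfl⟩ | ⟨p, hp, rfl⟩
      · exact Or.inl rfl
      · exact Or.inr ⟨x, hAB.ne, Sym2.eq_swap⟩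
      · simp at hp
      · exact Or.inr ⟨p, fun h => hAB.right_notMem_right (h ▸ hp), rfl⟩
    · obtain ⟨p, rfl⟩ := Finset.card_eq_one.1 ha
      obtain ⟨q, rfl⟩ := Finset.card_eq_one.1 hb
      have hpq : p = q := by
        by_contra hne
        simp [hne] at hc
      subst hpq
      have hpx : p ≠ x := fun h => hAB.left_notMem_left (by simp [h])
      have hpy : p ≠ y := fun h => hAB.right_notMem_left (by simp [h])
      -- The double star is the triangle `x, y, p` and `zw` hangs at `p`, so `p` takes the role of
      -- `u`.
      have key : ∀ v, p ≠ v → s(z, w) = s(p, v) → Nonempty (SGraph' t ≃g H) := by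
        intro v hpv hs
        refine nonempty_SGraph'_iso hW hm (u := p) (l := x) (c := y) hpx hpy hAB.ne ?_
        intro e he
        rw [← SimpleGraph.mem_edgeFinset, heq, Finset.mem_insert, mem_doubleStar, hs] at he
        rcases he with rfl | rfl | ⟨q, hq, rfl⟩ | ⟨q, hq, rfl⟩
        · exact Or.inr ⟨v, hpv.symm, rfl⟩
        · exact Or.inl rfl
        · rw [Finset.mem_singleton.1 hq]
          exact Or.inr ⟨x, hpx.symm, Sym2.eq_swap⟩
        · rw [Finset.mem_singleton.1 hq]
          exact Or.inr ⟨y, hpy.symm, Sym2.eq_swap⟩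
      rcases exists_of_card_inter_pair_eq_one ha' with ⟨hz, -⟩ | ⟨hw, -⟩ | h
      · obtain rfl := Finset.mem_singleton.1 hz
        exact key w hzw rfl
      · obtain rfl := Finset.mem_singleton.1 hw
        exact key z hzw.symm Sym2.eq_swap
      · exact absurd h hzw

/-! ### Comatching graphs for the exceptional `t` -/

section Comatching

theorem exists_SGraph_adj {t : ℕ} (v : KVertex 1 t) : ∃ w, (SGraph t).Adj v w := by
  by_cases hc : v = Sum.inl false
  · subst hc
    exact ⟨_, (SGraph_adj_leaf_center t).symm⟩
  by_cases hu : v = Sum.inl true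
  · subst hu
    exact ⟨Sum.inr (Sum.inl 0), SGraph_adj (by simp) (by simp)⟩
  · exact ⟨_, (SGraph_adj hu hc).symm⟩

theorem exists_SGraph'_adj {t : ℕ} (v : KVertex 1 t) : ∃ w, (SGraph' t).Adj v w := by
  obtain ⟨w, h⟩ := exists_SGraph_adj v
  exact ⟨w, Or.inl h⟩

/-- A graph without isolated vertices is comatching with every graph that has an isolated vertex
and the same matching polynomial. -/
theorem isComatching_of_isolated {V W : Type*} [Fintype V] [Fintype W] [DecidableEq W]
    {G : SimpleGraph V} {E : Finset (Sym2 W)} (hG : ∀ v, ∃ w, G.Adj v w)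
    (hE : ∀ e ∈ E, ¬ e.IsDiag) {v : W} (hv : ∀ e ∈ E, v ∉ e)
    (hcard : Fintype.card V = Fintype.card W) (hW : Fintype.card W < 8)
    (h1 : matchingNumber G 1 = E.card)
    (h2 : matchingNumber G 2 = (matchings E 2).card)
    (h3 : matchingNumber G 3 = (matchings E 3).card) :
    IsComatching G (SimpleGraph.fromEdgeSet (E : Set (Sym2 W))) := by
  have hset : (E : Set (Sym2 W)) = (SimpleGraph.fromEdgeSet (E : Set (Sym2 W))).edgeSet := by
    rw [SimpleGraph.edgeSet_fromEdgeSet, eq_comm, sdiff_eq_left, Set.disjoint_left]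
    exact hE
  constructor
  · constructor
    intro φ
    obtain ⟨w, hw⟩ := hG (φ.symm v)
    have h := φ.map_adj_iff.2 hw
    rw [φ.apply_symm_apply, SimpleGraph.fromEdgeSet_adj] at h
    exact hv _ h.1 (Sym2.mem_mk_left _ _)
  · refine matchingPolynomial_eq_iff.2 ⟨hcard, fun k => ?_⟩
    -- A 4-matching needs eight vertices, so only `k ≤ 3` has to be compared.
    by_cases hk : k < 4
    · interval_cases k
      · rw [matchingNumber_zero, matchingNumber_zero]
      · rw [h1, matchingNumber_eq_card hset, card_matchings_one]
      · rw [h2, matchingNumber_eq_card hset]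
      · rw [h3, matchingNumber_eq_card hset]
    · rw [matchingNumber_eq_zero G (by omega), matchingNumber_eq_zero _ (by omega)]

theorem not_isMatchingUnique_SGraph {n t : ℕ} (E : Finset (Sym2 (Fin n)))
    (hE : ∀ e ∈ E, ¬ e.IsDiag) (v : Fin n) (hv : ∀ e ∈ E, v ∉ e) (hn : n = t + 3) (ht : t ≤ 4)
    (h1 : E.card = t + 2) (h2 : (matchings E 2).card = t) (h3 : (matchings E 3).card = 0) :
    ¬ IsMatchingUnique (SGraph t) := by
  intro h
  obtain ⟨g1, g2, g3⟩ := matchingNumber_SGraph t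
  exact h (Fin n) _ (isComatching_of_isolated exists_SGraph_adj hE hv (by simp; omega)
    (by simp; omega) (by rw [g1, h1]) (by rw [g2, h2]) (by rw [g3 3 le_rfl, h3]))

theorem not_isMatchingUnique_SGraph' {n t : ℕ} (E : Finset (Sym2 (Fin n)))
    (hE : ∀ e ∈ E, ¬ e.IsDiag) (v : Fin n) (hv : ∀ e ∈ E, v ∉ e) (hn : n = t + 3) (ht : t ≤ 4)
    (h1 : E.card = t + 3) (h2 : (matchings E 2).card = t) (h3 : (matchings E 3).card = 0) :
    ¬ IsMatchingUnique (SGraph' t) := by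
  intro h
  obtain ⟨g1, g2, g3⟩ := matchingNumber_SGraph' t
  exact h (Fin n) _ (isComatching_of_isolated exists_SGraph'_adj hE hv (by simp; omega)
    (by simp; omega) (by rw [g1, h1]) (by rw [g2, h2]) (by rw [g3 3 le_rfl, h3]))

/-- The cycle `C₄` with an isolated vertex is comatching with `S(2)`. -/
theorem not_isMatchingUnique_SGraph_two : ¬ IsMatchingUnique (SGraph 2) :=
  not_isMatchingUnique_SGraph (n := 5) {s(0, 1), s(1, 2), s(2, 3), s(3, 0)} (by decide) 4
    (by decide) rfl (by decide) (by decide) (by decide +kernel) (by decide +kernel)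

/-- The bull with an isolated vertex is comatching with `S(3)`. -/
theorem not_isMatchingUnique_SGraph_three : ¬ IsMatchingUnique (SGraph 3) :=
  not_isMatchingUnique_SGraph (n := 6) {s(0, 1), s(1, 2), s(2, 0), s(0, 3), s(1, 4)} (by decide) 5
    (by decide) rfl (by decide) (by decide) (by decide +kernel) (by decide +kernel)

/-- `K₄` without an edge, with a pendant edge at a vertex of degree `3` and with two isolated
vertices, is comatching with `S(4)`. -/
theorem not_isMatchingUnique_SGraph_four : ¬ IsMatchingUnique (SGraph 4) :=
  not_isMatchingUnique_SGraph (n := 7) {s(0, 1), s(0, 2), s(0, 3), s(1, 2), s(1, 3), s(0, 4)}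
    (by decide) 5 (by decide) rfl (by decide) (by decide) (by decide +kernel)
    (by decide +kernel)

/-- `K₄` without an edge, with an isolated vertex, is comatching with `S'(2)`. -/
theorem not_isMatchingUnique_SGraph'_two : ¬ IsMatchingUnique (SGraph' 2) :=
  not_isMatchingUnique_SGraph' (n := 5) {s(0, 1), s(0, 2), s(0, 3), s(1, 2), s(1, 3)}
    (by decide) 4 (by decide) rfl (by decide) (by decide) (by decide +kernel)
    (by decide +kernel)

/-- `K₄` with two isolated vertices is comatching with `S'(3)`. -/
theorem not_isMatchingUnique_SGraph'_three : ¬ IsMatchingUnique (SGraph' 3) :=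
  not_isMatchingUnique_SGraph' (n := 6) {s(0, 1), s(0, 2), s(0, 3), s(1, 2), s(1, 3), s(2, 3)}
    (by decide) 4 (by decide) rfl (by decide) (by decide) (by decide +kernel)
    (by decide +kernel)

end Comatching

/-! ### The two characterizations -/

theorem isMatchingUnique_SGraph {t : ℕ} (ht : t ∉ ({2, 3, 4} : Set ℕ)) :
    IsMatchingUnique (SGraph t) := by
  rintro W _ H ⟨hiso, hpoly⟩
  obtain ⟨hc, hk⟩ := matchingPolynomial_eq_iff.1 hpoly
  obtain ⟨h1, h2, -⟩ := matchingNumber_SGraph t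
  refine not_nonempty_iff.2 hiso (nonempty_SGraph_iso_of_matchingNumber ht ?_ ?_ ?_)
  · rw [← hc]
    simp
    omega
  · rw [← hk, h1]
  · rw [← hk, h2]

theorem isMatchingUnique_SGraph' {t : ℕ} (ht : t ∉ ({2, 3} : Set ℕ)) :
    IsMatchingUnique (SGraph' t) := by
  rintro W _ H ⟨hiso, hpoly⟩
  obtain ⟨hc, hk⟩ := matchingPolynomial_eq_iff.1 hpoly
  obtain ⟨h1, h2, -⟩ := matchingNumber_SGraph' t
  refine not_nonempty_iff.2 hiso (nonempty_SGraph'_iso_of_matchingNumber ht ?_ ?_ ?_)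
  · rw [← hc]
    simp
    omega
  · rw [← hk, h1]
  · rw [← hk, h2]

theorem mainTheorem3 (t : ℕ) :
    (IsMatchingUnique (SGraph t) ↔ t ∉ ({2, 3, 4} : Set ℕ)) ∧
    (IsMatchingUnique (SGraph' t) ↔ t ∉ ({2, 3} : Set ℕ)) := by
  refine ⟨⟨?_, isMatchingUnique_SGraph⟩, ⟨?_, isMatchingUnique_SGraph'⟩⟩
  · rintro h (rfl | rfl | rfl)
    · exact not_isMatchingUnique_SGraph_two h
    · exact not_isMatchingUnique_SGraph_three h
    · exact not_isMatchingUnique_SGraph_four h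
  · rintro h (rfl | rfl)
    · exact not_isMatchingUnique_SGraph'_two h
    · exact not_isMatchingUnique_SGraph'_three h
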